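/- **Setting.** Let $\Omega\subset\mathbb R^3$ be a bounded Lipschitz domain that is simply connected with connected boundary, and let $0<\gamma$, $0<L$. Let $w:\overline\Omega\times\mathbb R^3\to\mathbb R$ be piecewise continuous in the first argument, with $w(x,\cdot)\in C^2(\mathbb R^3)$, $|w(x,0)|+|\partial_b w(x,0)|\le C$ and $$\gamma|\xi|^2\le\langle\partial_{bb}w(x,\eta)\xi,\xi\rangle\le L|\xi|^2\qquad\text{for all } x\in\overline\Omega,\ \xi,\eta\in\mathbb R^3 .$$ Let $\mathcal T_h$ be a finite, geometrically conforming, shape-regular tetrahedral partition of $\Omega$, and let $k\ge 0$. Let $h_s\in H(\operatorname{curl};\Omega)$ be a source field that is in $H^2(T)^3$ on every element $T$. Let $\langle u,v\rangle_h=\sum_{T}\sum_{j=1}^{\ell}u(x_{T,j})\cdot v(x_{T,j})\,\hat w_j|T|$, where the points $x_{T,j}$ are the images under the affine maps of points $\hat x_j$ of the closed reference tetrahedron, the weights $\hat w_j$ are positive, functions are evaluated element by element (for $h_s$, through its continuous representative on $T$), and $\langle u,v\rangle_h=\int_\Omega u\cdot v\,dx$ for all $u,v\in P_k(\mathcal T_h)^3$,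 the piecewise polynomial fields of degree at most $k$. Let $W_h=\mathcal N_k(\mathcal T_h)\cap H_0(\operatorname{curl};\Omega)$ be the Nédélec space of order $k$ (local space $(P_k)^3+x\times(\tilde P_k)^3$ with $\tilde P_k$ the homogeneous polynomials of degree $k$), let $S_h=P_{k+1}(\mathcal T_h)\cap H^1_0(\Omega)$, and let $V_h$ be a subspace with $W_h=\nabla S_h\oplus V_h$ and $\|v_h\|_{H(\operatorname{curl})}\le C_*\|\operatorname{curl}v_h\|_{L^2(\Omega)}$ for all $v_h\in V_h$ and some $C_*>0$. Put $$W(v_h)=\langle w(\operatorname{curl}v_h),1\rangle_h-\langle h_s,\operatorname{curl}v_h\rangle_h ,\qquad v_h\in V_h .$$ **Method.** Let $0<\rho\le\frac12$ and $0<\sigma<\frac12$. Given $a_h^0\in V_h$, set $a_h^{n+1}=a_h^n+\tau^n\delta a_h^n$ for $n\ge0$, where $\delta a_h^n\in V_h$ solves $$\langle\partial_{bb}w(\operatorname{curl}a_h^n)\operatorname{curl}\delta a_h^n,\operatorname{curl}v_h\rangle_h=-\langle\partial_bw(\operatorname{curl}a_h^n)-h_s,\operatorname{curl}v_h\rangle_h\qquad\text{for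 all }v_h\in V_h,$$ and $\tau^n$ is the largest $\tau\in\{\rho^m:m=0,1,2,\dots\}$ with $$W(a_h^n+\tau\,\delta a_h^n)\le W(a_h^n)+\sigma\tau\,\langle\partial_bw(\operatorname{curl}a_h^n)-h_s,\operatorname{curl}\delta a_h^n\rangle_h .$$ **Theorem 4 (Global linear convergence).** The functional $W$ has a unique minimizer $a_h$ over $V_h$, and for every $a_h^0\in V_h$ the method is well defined, i.e. it generates exactly one sequence of iterates, increments and step sizes. If $\delta a_h^n=0$ for some $n$, then the method has terminated at the solution: $a_h^m=a_h$ for all $m\ge n$. In any case, for all $n\ge0$, $$\|\operatorname{curl}(a_h^n-a_h)\|_{L^2(\Omega)}^2\le\frac L\gamma\,q^n\,\|\operatorname{curl}(a_h^0-a_h)\|_{L^2(\Omega)}^2,\qquad q=1-4\rho\sigma(1-\sigma)\frac{\gamma^3}{L^3},\quad 0<q<1 .$$ Thus the convergence is global (any $a_h^0\in V_h$) and r-linear, with constants that depend only on $\rho,\sigma,\gamma,L$ and not on the mesh or the polynomial degree. -/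

import Mathlib

open MeasureTheory Filter Topology
open scoped ContDiff

noncomputable section

namespace Magnetostatics

/-- Three-dimensional Euclidean space. -/
abbrev E3 : Type := EuclideanSpace ℝ (Fin 3)

/-! ### Differential operators and Sobolev spaces through test functions -/

/-- The partial derivative of `f` in the `i`-th coordinate direction (classical sense). -/
def partialD {F : Type*} [NormedAddCommGroup F] [NormedSpace ℝ F]
    (i : Fin 3) (f : E3 → F) (x : E3) : F :=
  fderiv ℝ f x (EuclideanSpace.single i 1)

/-- The classical curl of a vector field. -/
def curlField (φ : E3 → E3) (x : E3) : E3 :=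
  !₂[(partialD 1 φ x) 2 - (partialD 2 φ x) 1,
     (partialD 2 φ x) 0 - (partialD 0 φ x) 2,
     (partialD 0 φ x) 1 - (partialD 1 φ x) 0]

/-- Smooth compactly supported functions on the whole space. -/
def IsTest {F : Type*} [NormedAddCommGroup F] [NormedSpace ℝ F] (φ : E3 → F) : Prop :=
  ContDiff ℝ ∞ φ ∧ HasCompactSupport φ

/-- Square integrability on `U`. -/
def MemL2 {F : Type*} [NormedAddCommGroup F] (U : Set E3) (u : E3 → F) : Prop :=
  MemLp u 2 (volume.restrict U)

/-- `u ∈ H(curl; U)`: the distributional curl of `u` in `U` is square integrable. -/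
def MemHcurl (U : Set E3) (u : E3 → E3) : Prop :=
  MemL2 U u ∧ ∃ c : E3 → E3, MemL2 U c ∧
    ∀ φ : E3 → E3, IsTest φ → tsupport φ ⊆ U →
      ∫ x in U, inner ℝ (u x) (curlField φ x) = ∫ x in U, inner ℝ (c x) (φ x)

/-- `u ∈ H₀(curl; U)`: there is a square integrable curl and the tangential trace vanishes, that is,
Green's formula holds without boundary term for all smooth fields, which need not vanish
on the boundary of `U`. -/
def MemH0curl (U : Set E3) (u : E3 → E3) : Prop :=
  MemL2 U u ∧ ∃ c : E3 → E3, MemL2 U c ∧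
    ∀ φ : E3 → E3, IsTest φ →
      ∫ x in U, inner ℝ (u x) (curlField φ x) = ∫ x in U, inner ℝ (c x) (φ x)

/-- `u ∈ H₀¹(U)`: there is a square integrable gradient and the trace vanishes, that is,
integration by parts holds without boundary term for all smooth functions. -/
def MemH01 (U : Set E3) (u : E3 → ℝ) : Prop :=
  MemL2 U u ∧ ∀ i : Fin 3, ∃ g : E3 → ℝ, MemL2 U g ∧
    ∀ φ : E3 → ℝ, IsTest φ →
      ∫ x in U, u x * partialD i φ x = - ∫ x in U, g x * φ x

/-- `u ∈ Hᵐ(U)`: all weak partial derivatives up to order `m` are square integrable on `U`. -/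
def MemH (U : Set E3) : ℕ → (E3 → ℝ) → Prop
  | 0, u => MemL2 U u
  | m + 1, u => MemL2 U u ∧ ∀ i : Fin 3, ∃ g : E3 → ℝ, MemH U m g ∧
      ∀ φ : E3 → ℝ, IsTest φ → tsupport φ ⊆ U →
        ∫ x in U, u x * partialD i φ x = - ∫ x in U, g x * φ x

/-! ### The domain and the problem data -/

/-- Near every boundary point and after a rotation, `Ω` is the strict epigraph of a
Lipschitz function of two variables. -/
def HasLipschitzBoundary (Ω : Set E3) : Prop :=
  ∀ x ∈ frontier Ω, ∃ (R : E3 ≃ₗᵢ[ℝ] E3) (K : NNReal) (g : EuclideanSpace ℝ (Fin 2) → ℝ)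
    (U : Set E3), LipschitzWith K g ∧ IsOpen U ∧ x ∈ U ∧
      ∀ y ∈ U, (y ∈ Ω ↔ g !₂[(R y) 0, (R y) 1] < (R y) 2)

/-- A bounded Lipschitz domain that is simply connected and has a connected boundary. -/
structure IsTrivialLipschitzDomain (Ω : Set E3) : Prop where
  isOpen : IsOpen Ω
  bounded : Bornology.IsBounded Ω
  lipschitz : HasLipschitzBoundary Ω
  simplyConnected : SimplyConnectedSpace Ω
  boundary_connected : IsConnected (frontier Ω)

/-- `f x η` is piecewise continuous in `x`: there is a partition of `Ω` into finitely many open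
pieces on each of which `f · η` extends continuously to the closure of the piece. -/
def PiecewiseContinuous (Ω : Set E3) (f : E3 → E3 → ℝ) : Prop :=
  ∃ (m : ℕ) (U : Fin m → Set E3),
    (∀ i, IsOpen (U i) ∧ U i ⊆ Ω) ∧ Pairwise (fun i j => Disjoint (U i) (U j)) ∧
    (⋃ i, closure (U i)) = closure Ω ∧
    ∀ (i : Fin m) (η : E3), ∃ g : E3 → ℝ, ContinuousOn g (closure (U i)) ∧
      ∀ x ∈ U i, f x η = g x

/-- `∂_b w (x, b)`. -/
def dw (w : E3 → E3 → ℝ) (x b : E3) : E3 := gradient (w x) b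

/-- `∂_bb w (x, b)`, the Hessian, as a linear map. -/
def ddw (w : E3 → E3 → ℝ) (x b : E3) : E3 →L[ℝ] E3 := fderiv ℝ (dw w x) b

/-- The conditions on the domain, on the energy density `w` and on the source field `hs`. -/
structure ProblemData (Ω : Set E3) (w : E3 → E3 → ℝ) (hs : E3 → E3) (γ L : ℝ) : Prop where
  domain : IsTrivialLipschitzDomain Ω
  γ_pos : 0 < γ
  L_pos : 0 < L
  piecewise : PiecewiseContinuous Ω w
  smooth : ∀ x ∈ closure Ω, ContDiff ℝ 2 (w x)
  bounded_at_zero : ∃ C : ℝ, ∀ x ∈ closure Ω, |w x 0| + ‖dw w x 0‖ ≤ C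
  lower : ∀ x ∈ closure Ω, ∀ ξ η : E3, γ * ‖ξ‖ ^ 2 ≤ inner ℝ (ddw w x η ξ) ξ
  upper : ∀ x ∈ closure Ω, ∀ ξ η : E3, inner ℝ (ddw w x η ξ) ξ ≤ L * ‖ξ‖ ^ 2
  source : MemHcurl Ω hs

/-! ### Tetrahedral meshes and quadrature -/

/-- The closed tetrahedron spanned by four affinely independent points. -/
def tet (S : Affine.Simplex ℝ E3 3) : Set E3 := convexHull ℝ (Set.range S.points)

/-- The tetrahedra `T i` form a geometrically conforming simplicial partition of `Ω`. -/
structure IsConformingMesh {ι : Type*} (Ω : Set E3) (T : ι → Affine.Simplex ℝ E3 3) : Prop where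
  cover : (⋃ i, tet (T i)) = closure Ω
  distinct : ∀ i j, i ≠ j → Set.range (T i).points ≠ Set.range (T j).points
  conforming : ∀ i j, i ≠ j →
    tet (T i) ∩ tet (T j) = convexHull ℝ (Set.range (T i).points ∩ Set.range (T j).points)

/-- Shape regularity with constant `κ`: every element contains a ball whose radius is comparable
to the diameter of the element. -/
def IsShapeRegular {ι : Type*} (κ : ℝ) (T : ι → Affine.Simplex ℝ E3 3) : Prop :=
  ∀ i, ∃ (c : E3) (r : ℝ), 0 < r ∧ Metric.ball c r ⊆ tet (T i) ∧
    Metric.diam (tet (T i)) ≤ κ * r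

/-- A quadrature rule with `ℓ` points and positive weights on the reference tetrahedron with
vertices `0, e₁, e₂, e₃`. The weights are relative to the volume of the element. -/
structure QuadRule (ℓ : ℕ) where
  pt : Fin ℓ → E3
  wt : Fin ℓ → ℝ
  pt_nonneg : ∀ j i, 0 ≤ (pt j) i
  pt_sum_le : ∀ j, ∑ i, (pt j) i ≤ 1
  wt_pos : ∀ j, 0 < wt j

/-- The affine map from the reference tetrahedron onto the tetrahedron `S`. -/
def refMap (S : Affine.Simplex ℝ E3 3) (y : E3) : E3 :=
  S.points 0 + ∑ i : Fin 3, y i • (S.points i.succ - S.points 0)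

/-- Numerical integration over the mesh of a function that is given element by element (and
hence may have different values on the two sides of a face). -/
def quad {ι : Type*} [Fintype ι] {ℓ : ℕ} (T : ι → Affine.Simplex ℝ E3 3) (Q : QuadRule ℓ)
    (f : ι → E3 → ℝ) : ℝ :=
  ∑ i, ∑ j, f i (refMap (T i) (Q.pt j)) * Q.wt j * volume.real (tet (T i))

/-- The value at `x ∈ S` of the continuous representative of `h` on `S`, as the limit of the mean
values over `S ∩ B(x, r)` for `r → 0`. -/
def elementValue (h : E3 → E3) (S : Set E3) (x : E3) : E3 :=
  limUnder (𝓝[>] (0 : ℝ)) fun r => ⨍ y in S ∩ Metric.ball x r, h y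

/-! ### Piecewise polynomials and finite element spaces -/

/-- Scalar polynomials in three variables. -/
abbrev Poly : Type := MvPolynomial (Fin 3) ℝ

/-- Polynomial vector fields. -/
abbrev PolyVec : Type := Fin 3 → Poly

/-- The function on space defined by a polynomial. -/
def evalS (p : Poly) (x : E3) : ℝ := MvPolynomial.eval (fun i => x i) p

/-- The vector field on space defined by a polynomial vector field. -/
def evalV (p : PolyVec) (x : E3) : E3 := WithLp.toLp 2 fun i => evalS (p i) x

/-- The gradient of a polynomial. -/
def gradP : Poly →ₗ[ℝ] PolyVec :=
  LinearMap.pi fun i => (MvPolynomial.pderiv (R := ℝ) i).toLinearMap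

/-- The curl of a polynomial vector field. -/
def curlP (p : PolyVec) : PolyVec :=
  ![MvPolynomial.pderiv 1 (p 2) - MvPolynomial.pderiv 2 (p 1),
    MvPolynomial.pderiv 2 (p 0) - MvPolynomial.pderiv 0 (p 2),
    MvPolynomial.pderiv 0 (p 1) - MvPolynomial.pderiv 1 (p 0)]

/-- The elementwise curl of a piecewise polynomial vector field. -/
def curlPw {ι : Type*} (v : ι → PolyVec) : ι → PolyVec := fun i => curlP (v i)

/-- The scalar function on space that is given on (the interior of) the `i`-th element by the
`i`-th polynomial. -/
def glueS {ι : Type*} [Fintype ι] (T : ι → Affine.Simplex ℝ E3 3) (u : ι → Poly) (x : E3) : ℝ :=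
  ∑ i, (interior (tet (T i))).indicator (evalS (u i)) x

/-- The vector field on space that is given on (the interior of) the `i`-th element by the
`i`-th polynomial vector field. -/
def glueV {ι : Type*} [Fintype ι] (T : ι → Affine.Simplex ℝ E3 3) (u : ι → PolyVec) (x : E3) : E3 :=
  ∑ i, (interior (tet (T i))).indicator (evalV (u i)) x

/-- The square of the `L²(Ω)` norm of a piecewise polynomial vector field. -/
def normSqL2 {ι : Type*} [Fintype ι] (Ω : Set E3) (T : ι → Affine.Simplex ℝ E3 3)
    (u : ι → PolyVec) : ℝ :=
  ∫ x in Ω, ‖glueV T u x‖ ^ 2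

/-- The quadrature rule integrates the product of two piecewise polynomial vector fields of
degree at most `k` exactly. -/
def IsExact {ι : Type*} [Fintype ι] {ℓ : ℕ} (Ω : Set E3) (T : ι → Affine.Simplex ℝ E3 3)
    (Q : QuadRule ℓ) (k : ℕ) : Prop :=
  ∀ u v : ι → PolyVec,
    (∀ i j, u i j ∈ MvPolynomial.restrictTotalDegree (Fin 3) ℝ k) →
    (∀ i j, v i j ∈ MvPolynomial.restrictTotalDegree (Fin 3) ℝ k) →
    quad T Q (fun i x => inner ℝ (evalV (u i) x) (evalV (v i) x)) =
      ∫ x in Ω, inner ℝ (glueV T u x) (glueV T v x)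

/-- The local Nédélec space (first family) `(P_k)³ + x × (P̃_k)³`, where `P̃_k` are the
homogeneous polynomials of degree `k`. -/
def nedelecLocal (k : ℕ) : Submodule ℝ PolyVec where
  carrier := {v | ∃ p q : PolyVec, (∀ i, p i ∈ MvPolynomial.restrictTotalDegree (Fin 3) ℝ k) ∧
    (∀ i, q i ∈ MvPolynomial.homogeneousSubmodule (Fin 3) ℝ k) ∧
    v = p + crossProduct (fun i => (MvPolynomial.X i : Poly)) q}
  zero_mem' := ⟨0, 0, fun _ => Submodule.zero_mem _, fun _ => Submodule.zero_mem _, by simp⟩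
  add_mem' := by
    rintro _ _ ⟨p, q, hp, hq, rfl⟩ ⟨p', q', hp', hq', rfl⟩
    exact ⟨p + p', q + q', fun i => Submodule.add_mem _ (hp i) (hp' i),
      fun i => Submodule.add_mem _ (hq i) (hq' i), by rw [map_add]; abel⟩
  smul_mem' := by
    rintro c _ ⟨p, q, hp, hq, rfl⟩
    refine ⟨c • p, c • q, fun i => Submodule.smul_mem _ c (hp i),
      fun i => Submodule.smul_mem _ c (hq i), ?_⟩
    rw [smul_add, LinearMap.map_smul_of_tower]

theorem evalS_add (p q : Poly) : evalS (p + q) = evalS p + evalS q := by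
  ext x; simp [evalS]

theorem evalS_smul (c : ℝ) (p : Poly) : evalS (c • p) = c • evalS p := by
  ext x; simp [evalS, MvPolynomial.smul_eval]

theorem evalV_add (p q : PolyVec) : evalV (p + q) = evalV p + evalV q := by
  ext x i; simp [evalV, evalS_add]

theorem evalV_smul (c : ℝ) (p : PolyVec) : evalV (c • p) = c • evalV p := by
  ext x i; simp [evalV, evalS_smul]

section glue

variable {ι : Type*} [Fintype ι] (T : ι → Affine.Simplex ℝ E3 3)

theorem glueS_add (u v : ι → Poly) : glueS T (u + v) = glueS T u + glueS T v := by
  ext x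
  simp [glueS, evalS_add, Set.indicator_add', Finset.sum_add_distrib]

theorem glueS_smul (c : ℝ) (u : ι → Poly) : glueS T (c • u) = c • glueS T u := by
  ext x
  simp only [glueS, Pi.smul_apply, evalS_smul, Finset.smul_sum]
  exact Finset.sum_congr rfl fun i _ => by
    by_cases h : x ∈ interior (tet (T i)) <;> simp [h]

theorem glueV_add (u v : ι → PolyVec) : glueV T (u + v) = glueV T u + glueV T v := by
  ext1 x
  simp [glueV, evalV_add, Set.indicator_add', Finset.sum_add_distrib]

theorem glueV_smul (c : ℝ) (u : ι → PolyVec) : glueV T (c • u) = c • glueV T u := by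
  ext1 x
  simp only [glueV, Pi.smul_apply, evalV_smul, Finset.smul_sum]
  exact Finset.sum_congr rfl fun i _ => by
    by_cases h : x ∈ interior (tet (T i)) <;> simp [h]

end glue

theorem IsTest.memLp {F : Type*} [NormedAddCommGroup F] [NormedSpace ℝ F] {φ : E3 → F}
    (h : IsTest φ) (U : Set E3) : MemL2 U φ :=
  (h.1.continuous.memLp_of_hasCompactSupport h.2).restrict U

theorem IsTest.partialD {F : Type*} [NormedAddCommGroup F] [NormedSpace ℝ F] {φ : E3 → F}
    (h : IsTest φ) (i : Fin 3) : IsTest (partialD i φ) :=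
  ⟨(h.1.fderiv_right (m := ∞) (by simp)).clm_apply contDiff_const, h.2.fderiv_apply ℝ _⟩

theorem IsTest.curlField {φ : E3 → E3} (h : IsTest φ) (U : Set E3) : MemL2 U (curlField φ) := by
  have hc : ∀ i : Fin 3, Continuous (Magnetostatics.partialD i φ) :=
    fun i => (h.partialD i).1.continuous
  have h0 : ∀ i : Fin 3, ∀ x, x ∉ tsupport φ → Magnetostatics.partialD i φ x = 0 := by
    intro i x hx
    have : fderiv ℝ φ x = 0 := image_eq_zero_of_notMem_tsupport
      (fun hx' => hx (tsupport_fderiv_subset ℝ hx'))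
    simp [Magnetostatics.partialD, this]
  refine (Continuous.memLp_of_hasCompactSupport ?_ ?_).restrict U
  · refine (PiLp.continuous_toLp 2 _).comp (continuous_pi fun i => ?_)
    have hc' : ∀ i j : Fin 3, Continuous fun x => (Magnetostatics.partialD i φ x) j :=
      fun i j => (PiLp.continuous_apply 2 _ j).comp (hc i)
    fin_cases i
    · exact (hc' 1 2).sub (hc' 2 1)
    · exact (hc' 2 0).sub (hc' 0 2)
    · exact (hc' 0 1).sub (hc' 1 0)
  · refine HasCompactSupport.intro h.2 fun x hx => ?_
    ext i
    fin_cases i <;> simp [Magnetostatics.curlField, h0 _ x hx]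

theorem MemL2.integrable_inner {U : Set E3} {u v : E3 → E3} (hu : MemL2 U u) (hv : MemL2 U v) :
    Integrable (fun x => inner ℝ (u x) (v x)) (volume.restrict U) := by
  refine (MemLp.norm hu).integrable_mul (MemLp.norm hv) |>.mono'
    (hu.aestronglyMeasurable.inner hv.aestronglyMeasurable)
    (Eventually.of_forall fun x => norm_inner_le_norm _ _)

theorem MemL2.integrable_mul' {U : Set E3} {u v : E3 → ℝ} (hu : MemL2 U u) (hv : MemL2 U v) :
    Integrable (fun x => u x * v x) (volume.restrict U) :=
  MemLp.integrable_mul hu hv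

theorem MemH0curl.zero (U : Set E3) : MemH0curl U 0 :=
  ⟨MemLp.zero, 0, MemLp.zero, by simp⟩

theorem MemH0curl.add {U : Set E3} {u v : E3 → E3} (hu : MemH0curl U u) (hv : MemH0curl U v) :
    MemH0curl U (u + v) := by
  obtain ⟨hu, c, hc, h⟩ := hu
  obtain ⟨hv, d, hd, h'⟩ := hv
  refine ⟨MemLp.add hu hv, c + d, MemLp.add hc hd, fun φ hφ => ?_⟩
  simp only [Pi.add_apply, inner_add_left]
  rw [integral_add (hu.integrable_inner (hφ.curlField U)) (hv.integrable_inner (hφ.curlField U)),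
    integral_add (hc.integrable_inner (hφ.memLp U)) (hd.integrable_inner (hφ.memLp U)),
    h φ hφ, h' φ hφ]

theorem MemH0curl.smul {U : Set E3} {u : E3 → E3} (a : ℝ) (hu : MemH0curl U u) :
    MemH0curl U (a • u) := by
  obtain ⟨hu, c, hc, h⟩ := hu
  refine ⟨MemLp.const_smul hu a, a • c, MemLp.const_smul hc a, fun φ hφ => ?_⟩
  simp only [Pi.smul_apply, real_inner_smul_left, integral_const_mul, h φ hφ]

theorem MemH01.zero (U : Set E3) : MemH01 U 0 :=
  ⟨MemLp.zero, fun _ => ⟨0, MemLp.zero, by simp⟩⟩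

theorem MemH01.add {U : Set E3} {u v : E3 → ℝ} (hu : MemH01 U u) (hv : MemH01 U v) :
    MemH01 U (u + v) := by
  refine ⟨MemLp.add hu.1 hv.1, fun i => ?_⟩
  obtain ⟨c, hc, h⟩ := hu.2 i
  obtain ⟨d, hd, h'⟩ := hv.2 i
  refine ⟨c + d, MemLp.add hc hd, fun φ hφ => ?_⟩
  simp only [Pi.add_apply, add_mul]
  rw [integral_add (hu.1.integrable_mul' ((hφ.partialD i).memLp U))
      (hv.1.integrable_mul' ((hφ.partialD i).memLp U)),
    integral_add (hc.integrable_mul' (hφ.memLp U)) (hd.integrable_mul' (hφ.memLp U)),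
    h φ hφ, h' φ hφ]
  ring

theorem MemH01.smul {U : Set E3} {u : E3 → ℝ} (a : ℝ) (hu : MemH01 U u) :
    MemH01 U (a • u) := by
  refine ⟨MemLp.const_smul hu.1 a, fun i => ?_⟩
  obtain ⟨c, hc, h⟩ := hu.2 i
  refine ⟨a • c, MemLp.const_smul hc a, fun φ hφ => ?_⟩
  simp only [Pi.smul_apply, smul_eq_mul, mul_assoc, integral_const_mul, h φ hφ, mul_neg]

/-- `W_h = N_k(T_h) ∩ H₀(curl; Ω)`. A piecewise polynomial is represented by the family of its
polynomials on the elements. -/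
def nedelecSpace {ι : Type*} [Fintype ι] (Ω : Set E3) (T : ι → Affine.Simplex ℝ E3 3) (k : ℕ) :
    Submodule ℝ (ι → PolyVec) where
  carrier := {v | (∀ i, v i ∈ nedelecLocal k) ∧ MemH0curl Ω (glueV T v)}
  zero_mem' := by
    refine ⟨fun _ => Submodule.zero_mem _, ?_⟩
    have : glueV T (0 : ι → PolyVec) = 0 := by simpa using glueV_smul T 0 0
    rw [this]; exact MemH0curl.zero Ω
  add_mem' := fun hu hv => ⟨fun i => Submodule.add_mem _ (hu.1 i) (hv.1 i), by
    rw [glueV_add]; exact hu.2.add hv.2⟩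
  smul_mem' := fun c _ hu => ⟨fun i => Submodule.smul_mem _ c (hu.1 i), by
    rw [glueV_smul]; exact hu.2.smul c⟩

/-- `S_h = P_{k+1}(T_h) ∩ H₀¹(Ω)`. -/
def lagrangeSpace {ι : Type*} [Fintype ι] (Ω : Set E3) (T : ι → Affine.Simplex ℝ E3 3) (k : ℕ) :
    Submodule ℝ (ι → Poly) where
  carrier := {u | (∀ i, u i ∈ MvPolynomial.restrictTotalDegree (Fin 3) ℝ (k + 1)) ∧
    MemH01 Ω (glueS T u)}
  zero_mem' := by
    refine ⟨fun _ => Submodule.zero_mem _, ?_⟩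
    have : glueS T (0 : ι → Poly) = 0 := by simpa using glueS_smul T 0 0
    rw [this]; exact MemH01.zero Ω
  add_mem' := fun hu hv => ⟨fun i => Submodule.add_mem _ (hu.1 i) (hv.1 i), by
    rw [glueS_add]; exact hu.2.add hv.2⟩
  smul_mem' := fun c _ hu => ⟨fun i => Submodule.smul_mem _ c (hu.1 i), by
    rw [glueS_smul]; exact hu.2.smul c⟩

/-- `∇ S_h`. -/
def gradLagrange {ι : Type*} [Fintype ι] (Ω : Set E3) (T : ι → Affine.Simplex ℝ E3 3) (k : ℕ) :
    Submodule ℝ (ι → PolyVec) :=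
  (lagrangeSpace Ω T k).map (gradP.compLeft ι)

/-- The conditions on the discretization: a conforming and shape-regular mesh, a quadrature rule
that is exact of degree `2k`, a stable splitting `W_h = ∇ S_h ⊕ V_h`, and a source field that is
piecewise in `H²`. -/
structure DiscreteData {ι : Type*} [Fintype ι] {ℓ : ℕ} (Ω : Set E3) (hs : E3 → E3)
    (T : ι → Affine.Simplex ℝ E3 3) (κ : ℝ) (k : ℕ) (Q : QuadRule ℓ)
    (Vh : Submodule ℝ (ι → PolyVec)) (Cstar : ℝ) : Prop where
  mesh : IsConformingMesh Ω T
  shape : IsShapeRegular κ T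
  exact : IsExact Ω T Q k
  split_disjoint : gradLagrange Ω T k ⊓ Vh = ⊥
  split_sup : gradLagrange Ω T k ⊔ Vh = nedelecSpace Ω T k
  stable : 0 < Cstar ∧ ∀ v ∈ Vh,
    Real.sqrt (normSqL2 Ω T v + normSqL2 Ω T (curlPw v)) ≤
      Cstar * Real.sqrt (normSqL2 Ω T (curlPw v))
  source : ∀ (i : ι) (j : Fin 3), MemH (interior (tet (T i))) 2 fun x => (hs x) j

/-! ### The discrete energy and the damped Newton method -/

section newton

variable {ι : Type*} [Fintype ι] {ℓ : ℕ} (T : ι → Affine.Simplex ℝ E3 3) (Q : QuadRule ℓ)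
  (w : E3 → E3 → ℝ) (hs : E3 → E3)

/-- `W(v) = ⟨w(curl v), 1⟩_h - ⟨h_s, curl v⟩_h`. -/
def energy (v : ι → PolyVec) : ℝ :=
  quad T Q (fun i x => w x (evalV (curlPw v i) x)) -
    quad T Q (fun i x => inner ℝ (elementValue hs (tet (T i)) x) (evalV (curlPw v i) x))

/-- `⟨∂_b w(curl a) - h_s, curl v⟩_h`. -/
def residual (a v : ι → PolyVec) : ℝ :=
  quad T Q fun i x => inner ℝ
    (dw w x (evalV (curlPw a i) x) - elementValue hs (tet (T i)) x) (evalV (curlPw v i) x)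

/-- `⟨∂_bb w(curl a) curl d, curl v⟩_h`. -/
def hessianForm (a d v : ι → PolyVec) : ℝ :=
  quad T Q fun i x => inner ℝ
    (ddw w x (evalV (curlPw a i) x) (evalV (curlPw d i) x)) (evalV (curlPw v i) x)

/-- The solution of the discrete minimization problem over `V_h`. -/
def IsDiscreteSolution (Vh : Submodule ℝ (ι → PolyVec)) (a : ι → PolyVec) : Prop :=
  a ∈ Vh ∧ ∀ v ∈ Vh, energy T Q w hs a ≤ energy T Q w hs v

/-- `a` are iterates with increments `δ` and step sizes `τ` generated by the Newton method with
Armijo backtracking (parameters `ρ`, `σ`), started at `a0`. -/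
structure IsNewtonArmijo (Vh : Submodule ℝ (ι → PolyVec)) (ρ σ : ℝ) (a0 : ι → PolyVec)
    (a δ : ℕ → ι → PolyVec) (τ : ℕ → ℝ) : Prop where
  init : a 0 = a0
  increment_mem : ∀ n, δ n ∈ Vh
  increment : ∀ n, ∀ v ∈ Vh, hessianForm T Q w (a n) (δ n) v = - residual T Q w hs (a n) v
  step : ∀ n, IsGreatest {t : ℝ | (∃ m : ℕ, t = ρ ^ m) ∧
    energy T Q w hs (a n + t • δ n) ≤
      energy T Q w hs (a n) + σ * t * residual T Q w hs (a n) (δ n)} (τ n)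
  update : ∀ n, a (n + 1) = a n + τ n • δ n

end newton

end Magnetostatics

end

open Magnetostatics

namespace Magnetostatics

/-! On `Vh` the curl is piecewise polynomial of degree at most `k`, so the quadrature computes its
L² norm exactly. Positive weights turn the pointwise Hessian bounds into γ-convexity and
L-smoothness of the discrete energy in `N v = ‖curl v‖²`, and stability of the splitting makes `N`
definite on `Vh`. What remains is an abstract argument about `IsNewtonModel`.

A Newton direction satisfies `H d d = -R d`. Smoothness makes Armijo accept every step up to
`2(1-σ)γ/L`, so backtracking stops no lower than ρ times that (`step_lower_bound`). Convexity bounds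
the energy gap by `L/(2γ) * H d d` (`gap_le_hess`). Together, one step removes at least the fraction
`4ρσ(1-σ)γ²/L²` of the gap (`gap_contraction`), hence also the fraction with `γ³/L³`. At the
minimizer the linear term vanishes, so the gap lies between `γ/2 * N` and `L/2 * N` of the error;
this yields the factor `L/γ`. -/

/-- An energy `F` with first variation `R` and second variation `H` that is strongly convex and
smooth with respect to the quadratic functional `N`, which is definite on `V`. -/
structure IsNewtonModel {P : Type*} [AddCommGroup P] [Module ℝ P] (V : Submodule ℝ P)
    (F : P → ℝ) (R : P → P →ₗ[ℝ] ℝ) (H : P → P →ₗ[ℝ] P →ₗ[ℝ] ℝ) (N : P → ℝ) (γ L : ℝ) :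
    Prop where
  pos : 0 < γ
  le : γ ≤ L
  lower : ∀ a d, F a + R a d + γ / 2 * N d ≤ F (a + d)
  upper : ∀ a d, F (a + d) ≤ F a + R a d + L / 2 * N d
  hess_lower : ∀ a d, γ * N d ≤ H a d d
  hess_upper : ∀ a d, H a d d ≤ L * N d
  symm : ∀ a d e, H a d e = H a e d
  smul : ∀ (t : ℝ) d, N (t • d) = t ^ 2 * N d
  nonneg : ∀ d, 0 ≤ N d
  definite : ∀ d ∈ V, N d = 0 → d = 0

/-! ### Abstract damped Newton method with Armijo backtracking. -/

namespace IsNewtonModel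

variable {P : Type*} [AddCommGroup P] [Module ℝ P] {V : Submodule ℝ P}
  {F : P → ℝ} {R : P → P →ₗ[ℝ] ℝ} {H : P → P →ₗ[ℝ] P →ₗ[ℝ] ℝ} {N : P → ℝ} {γ L : ℝ}

theorem eq_of_nonpos (h : IsNewtonModel V F R H N γ L) {a b : P} (ha : a ∈ V) (hb : b ∈ V)
    (hN : N (a - b) ≤ 0) : a = b :=
  sub_eq_zero.1 (h.definite _ (V.sub_mem ha hb) (le_antisymm hN (h.nonneg _)))

/-- Coercivity and definiteness make `H a` injective from `V` to its dual, and finite dimension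
makes it bijective. -/
theorem existsUnique_direction (h : IsNewtonModel V F R H N γ L) [FiniteDimensional ℝ V] (a : P) :
    ∃! d, d ∈ V ∧ ∀ v ∈ V, H a d v = - R a v := by
  have hzero : ∀ d ∈ V, (∀ v ∈ V, H a d v = 0) → d = 0 := by
    intro d hd h0
    refine h.definite d hd (le_antisymm ?_ (h.nonneg d))
    have h1 := h.hess_lower a d
    rw [h0 d hd] at h1
    nlinarith [h.pos]
  let A : V →ₗ[ℝ] Module.Dual ℝ V := ((H a).comp V.subtype).compr₂ LinearMap.id |>.compl₂ V.subtype
  have hA : ∀ d v : V, A d v = H a d v := fun _ _ => rfl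
  have hinj : Function.Injective A := by
    rw [← LinearMap.ker_eq_bot, LinearMap.ker_eq_bot']
    intro d hd
    refine Subtype.ext (hzero d d.2 fun v hv => ?_)
    rw [← hA d ⟨v, hv⟩, hd]; rfl
  have hsurj : Function.Surjective A :=
    (LinearMap.injective_iff_surjective_of_finrank_eq_finrank
      (Subspace.dual_finrank_eq (K := ℝ) (V := V)).symm).1 hinj
  obtain ⟨d, hd⟩ := hsurj (-((R a).comp V.subtype))
  refine ⟨d, ⟨d.2, fun v hv => ?_⟩, fun e he => ?_⟩
  · rw [← hA d ⟨v, hv⟩, hd]; rfl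
  · refine sub_eq_zero.1 (hzero _ (V.sub_mem he.1 d.2) fun v hv => ?_)
    rw [map_sub, LinearMap.sub_apply, he.2 v hv, ← hA d ⟨v, hv⟩, hd]
    simp

/-- The quadratic term is at most `t² L/2 * N d ≤ t² L/(2γ) * (-R a d)`, which for such `t` costs no
more than the fraction `1 - σ` of the linear decrease. -/
theorem armijo_of_le (h : IsNewtonModel V F R H N γ L) {a d : P} (hd : H a d d = - R a d)
    {σ t : ℝ} (ht : 0 ≤ t) (ht' : t ≤ 2 * (1 - σ) * (γ / L)) :
    F (a + t • d) ≤ F a + σ * t * R a d := by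
  have hL : 0 < L := h.pos.trans_le h.le
  have h1 := h.upper a (t • d)
  rw [map_smul, smul_eq_mul, h.smul] at h1
  have h2 := h.hess_lower a d
  have h3 : t * L ≤ 2 * (1 - σ) * γ := by
    calc t * L ≤ 2 * (1 - σ) * (γ / L) * L := by gcongr
      _ = _ := by field_simp
  have h4 := mul_le_mul_of_nonneg_right h3 (mul_nonneg ht (h.nonneg d))
  -- The sign of `1 - σ` is forced by `0 ≤ t * L ≤ 2 * (1 - σ) * γ`.
  have hσ : 0 ≤ 1 - σ := by
    by_contra hc
    push Not at hc
    nlinarith [mul_nonneg ht hL.le, h.pos]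
  have h5 := mul_le_mul_of_nonneg_left h2 (mul_nonneg ht hσ)
  rw [hd] at h5
  nlinarith

theorem exists_step (h : IsNewtonModel V F R H N γ L) {a d : P} (hd : H a d d = - R a d)
    {ρ σ : ℝ} (hρ : 0 < ρ) (hρ' : ρ ≤ 1 / 2) (hσ' : σ < 1 / 2) :
    ∃ τ, IsGreatest {t : ℝ | (∃ m : ℕ, t = ρ ^ m) ∧ F (a + t • d) ≤ F a + σ * t * R a d} τ := by
  classical
  have hL : 0 < L := h.pos.trans_le h.le
  have hex : ∃ m : ℕ, F (a + ρ ^ m • d) ≤ F a + σ * ρ ^ m * R a d := by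
    have hb : 0 < 2 * (1 - σ) * (γ / L) := by
      have := div_pos h.pos hL
      have : 0 < 1 - σ := by linarith
      positivity
    obtain ⟨m, hm⟩ := exists_pow_lt_of_lt_one hb (show ρ < 1 by linarith)
    exact ⟨m, h.armijo_of_le hd (by positivity) hm.le⟩
  refine ⟨ρ ^ Nat.find hex, ⟨⟨_, rfl⟩, Nat.find_spec hex⟩, ?_⟩
  rintro _ ⟨⟨m, rfl⟩, hm⟩
  exact pow_le_pow_of_le_one hρ.le (by linarith) (Nat.find_min' hex hm)

/-- If the step is not 1, the previous trial `τ / ρ` was rejected and so exceeds the threshold of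
`armijo_of_le`. For the step 1, `ρ ≤ 1/2` and `γ ≤ L` suffice. -/
theorem step_lower_bound (h : IsNewtonModel V F R H N γ L) {a d : P} (hd : H a d d = - R a d)
    {ρ σ τ : ℝ} (hρ : 0 < ρ) (hρ' : ρ ≤ 1 / 2) (hσ : 0 < σ) (hσ' : σ < 1 / 2)
    (hτ : IsGreatest {t : ℝ | (∃ m : ℕ, t = ρ ^ m) ∧
      F (a + t • d) ≤ F a + σ * t * R a d} τ) :
    2 * ρ * (1 - σ) * (γ / L) ≤ τ := by
  have hL : 0 < L := h.pos.trans_le h.le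
  have hq : γ / L ≤ 1 := (div_le_one hL).2 h.le
  have hq0 : 0 < γ / L := div_pos h.pos hL
  obtain ⟨⟨⟨m, rfl⟩, -⟩, hmax⟩ := hτ
  cases m with
  | zero =>
    rw [pow_zero]
    have h1 : 2 * ρ * (1 - σ) ≤ 1 := by nlinarith
    have h2 : 0 ≤ 2 * ρ * (1 - σ) := mul_nonneg (by linarith) (by linarith)
    nlinarith
  | succ m =>
    by_contra hc
    push Not at hc
    have h1 : ρ ^ m ≤ 2 * (1 - σ) * (γ / L) := by
      rw [pow_succ] at hc
      refine le_of_mul_le_mul_right (a := ρ) ?_ hρ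
      linarith
    have h2 : ρ ^ m ≤ ρ ^ (m + 1) :=
      hmax ⟨⟨m, rfl⟩, h.armijo_of_le hd (by positivity) h1⟩
    have h3 : 0 < ρ ^ m := by positivity
    rw [pow_succ] at h2
    nlinarith

/-- The upper bound along `t • v` is a quadratic in `t` without constant term that is nonnegative
everywhere; its discriminant `(R a v)²` must be nonpositive. -/
theorem first_variation_eq_zero (h : IsNewtonModel V F R H N γ L) {a : P}
    (hmin : a ∈ V ∧ ∀ v ∈ V, F a ≤ F v) {v : P} (hv : v ∈ V) : R a v = 0 := by
  have hq : ∀ t : ℝ, 0 ≤ (L / 2 * N v) * (t * t) + R a v * t + 0 := by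
    intro t
    have h1 := h.upper a (t • v)
    have h2 := hmin.2 _ (V.add_mem hmin.1 (V.smul_mem t hv))
    rw [map_smul, smul_eq_mul, h.smul] at h1
    nlinarith
  have := discrim_le_zero hq
  rw [discrim] at this
  nlinarith

theorem gap_lower (h : IsNewtonModel V F R H N γ L) {a b : P}
    (hmin : a ∈ V ∧ ∀ v ∈ V, F a ≤ F v) (hb : b ∈ V) : γ / 2 * N (b - a) ≤ F b - F a := by
  have h1 := h.lower a (b - a)
  rw [h.first_variation_eq_zero hmin (V.sub_mem hb hmin.1), add_sub_cancel] at h1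
  linarith

theorem gap_upper (h : IsNewtonModel V F R H N γ L) {a b : P}
    (hmin : a ∈ V ∧ ∀ v ∈ V, F a ≤ F v) (hb : b ∈ V) : F b - F a ≤ L / 2 * N (b - a) := by
  have h1 := h.upper a (b - a)
  rw [h.first_variation_eq_zero hmin (V.sub_mem hb hmin.1), add_sub_cancel] at h1
  linarith

theorem eq_of_gap_nonpos (h : IsNewtonModel V F R H N γ L) {a b : P}
    (hmin : a ∈ V ∧ ∀ v ∈ V, F a ≤ F v) (hb : b ∈ V) (hgap : F b ≤ F a) : b = a := by
  refine h.eq_of_nonpos hb hmin.1 ?_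
  nlinarith [h.gap_lower hmin hb, h.pos]

/-- The energy error is controlled by the squared energy norm of the Newton direction. -/
theorem gap_le_hess (h : IsNewtonModel V F R H N γ L) {a b d : P} (ha : a ∈ V) (hb : b ∈ V)
    (hd : ∀ v ∈ V, H b d v = - R b v) : F b - F a ≤ L / (2 * γ) * H b d d := by
  have hγ := h.pos
  have hL : 0 < L := h.pos.trans_le h.le
  have h1 := h.lower b (a - b)
  rw [add_sub_cancel] at h1
  have h2 := hd _ (V.sub_mem ha hb)
  generalize a - b = e at h1 h2
  have h4 := h.hess_upper b e
  -- With this `c`, `c² H e e ≤ c γ N e`. So expanding `0 ≤ H (d - c e) (d - c e)` bounds `H d e` by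
  -- `H d d / (2c) + γ/2 * N e`, and convexity absorbs the last term.
  set c := γ / L with hc
  have hc0 : 0 < c := div_pos hγ hL
  have h5 : 0 ≤ H b (d - c • e) (d - c • e) :=
    (mul_nonneg h.pos.le (h.nonneg _)).trans (h.hess_lower b _)
  simp only [map_sub, LinearMap.sub_apply, map_smul, LinearMap.smul_apply, smul_eq_mul,
    h.symm b e d] at h5
  have h6 : c * c * H b e e ≤ c * γ * N e := by
    calc c * c * H b e e ≤ c * c * (L * N e) := by gcongr
      _ = c * γ * N e := by rw [hc]; field_simp
  have h7 : L / (2 * γ) = 1 / (2 * c) := by rw [hc]; field_simp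
  rw [h7, one_div_mul_eq_div, le_div_iff₀ (by positivity)]
  nlinarith

/-- One damped Newton step contracts the energy error. -/
theorem gap_contraction (h : IsNewtonModel V F R H N γ L) {a b d : P}
    (hmin : a ∈ V ∧ ∀ v ∈ V, F a ≤ F v) (hb : b ∈ V) (hd : d ∈ V)
    (hN : ∀ v ∈ V, H b d v = - R b v)
    {ρ σ τ : ℝ} (hρ : 0 < ρ) (hρ' : ρ ≤ 1 / 2) (hσ : 0 < σ) (hσ' : σ < 1 / 2)
    (hτ : IsGreatest {t : ℝ | (∃ m : ℕ, t = ρ ^ m) ∧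
      F (b + t • d) ≤ F b + σ * t * R b d} τ) :
    F (b + τ • d) - F a ≤ (1 - 4 * ρ * σ * (1 - σ) * (γ ^ 3 / L ^ 3)) * (F b - F a) := by
  have hγ := h.pos
  have hL : 0 < L := h.pos.trans_le h.le
  set c := γ / L with hc
  have hc0 : 0 < c := div_pos hγ hL
  have hc1 : c ≤ 1 := (div_le_one hL).2 h.le
  have h1 := h.step_lower_bound (hN d hd) hρ hρ' hσ hσ' hτ
  have h2 : 2 * c * (F b - F a) ≤ H b d d := by
    have h3 := h.gap_le_hess hmin.1 hb hN
    calc 2 * c * (F b - F a) ≤ 2 * c * (L / (2 * γ) * H b d d) := by gcongr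
      _ = H b d d := by rw [hc]; field_simp
  have h3 : F (b + τ • d) ≤ F b + σ * τ * R b d := hτ.1.2
  have hg : 0 ≤ F b - F a := sub_nonneg.2 (hmin.2 b hb)
  have hR : R b d = - H b d d := by rw [hN d hd]; ring
  have hs : 0 < 1 - σ := by linarith
  have h4 : σ * (2 * ρ * (1 - σ) * c) * (2 * c * (F b - F a)) ≤ σ * τ * H b d d := by
    have hτ0 : 0 ≤ τ := le_trans (by positivity) h1
    gcongr
  have h5 : γ ^ 3 / L ^ 3 = c ^ 3 := by rw [hc, div_pow]
  -- The argument gives the rate with `c ^ 2`; since `c ≤ 1`, the stated rate with `c ^ 3` is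
  -- weaker.
  have h6 : 4 * ρ * σ * (1 - σ) * c ^ 3 * (F b - F a) ≤
      4 * ρ * σ * (1 - σ) * c ^ 2 * (F b - F a) := by
    have : c ^ 3 ≤ c ^ 2 := pow_le_pow_of_le_one hc0.le hc1 (by norm_num)
    gcongr
  rw [hR] at h3
  rw [h5]
  nlinarith

end IsNewtonModel

/-! ### Second order Taylor bounds -/

/-- Two monotonicity arguments replace the integral remainder, so `g''` need not be continuous. -/
theorem taylor_lower_of_le_second_deriv {g g' g'' : ℝ → ℝ} (h1 : ∀ t, HasDerivAt g (g' t) t)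
    (h2 : ∀ t, HasDerivAt g' (g'' t) t) {c : ℝ} (hc : ∀ t, c ≤ g'' t) :
    g 0 + g' 0 + c / 2 ≤ g 1 := by
  have hφ : Monotone fun t => g' t - c * t := by
    have hd : ∀ t, HasDerivAt (fun t => g' t - c * t) (g'' t - c * 1) t :=
      fun t => (h2 t).sub ((hasDerivAt_id t).const_mul c)
    refine monotone_of_deriv_nonneg (fun t => (hd t).differentiableAt) fun t => ?_
    rw [(hd t).deriv]
    linarith [hc t]
  have hψ : MonotoneOn (fun t => g t - g' 0 * t - c / 2 * t ^ 2) (Set.Ici 0) := by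
    have hd : ∀ t, HasDerivAt (fun t => g t - g' 0 * t - c / 2 * t ^ 2)
        (g' t - g' 0 * 1 - c / 2 * (2 * t ^ 1 * 1)) t := fun t =>
      ((h1 t).sub ((hasDerivAt_id t).const_mul _)).sub (((hasDerivAt_id t).pow 2).const_mul _)
    refine monotoneOn_of_deriv_nonneg (convex_Ici 0)
      (fun t _ => (hd t).continuousAt.continuousWithinAt)
      (fun t _ => (hd t).differentiableAt.differentiableWithinAt) fun t ht => ?_
    rw [interior_Ici] at ht
    have h3 : g' 0 - c * 0 ≤ g' t - c * t := hφ (le_of_lt ht)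
    rw [(hd t).deriv]
    linarith
  have h4 : g 0 - g' 0 * 0 - c / 2 * 0 ^ 2 ≤ g 1 - g' 0 * 1 - c / 2 * 1 ^ 2 :=
    hψ (Set.mem_Ici.2 le_rfl) (Set.mem_Ici.2 zero_le_one) zero_le_one
  linarith

/-! ### Pointwise convexity, smoothness and coercivity of the energy density. -/

section density

variable {w : E3 → E3 → ℝ} {x : E3}

theorem hasGradientAt_dw (hw : ContDiff ℝ 2 (w x)) (b : E3) :
    HasGradientAt (w x) (dw w x b) b :=
  ((hw.differentiable (by norm_num)) b).hasGradientAt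

theorem dw_eq (w : E3 → E3 → ℝ) (x : E3) :
    dw w x = fun b => (InnerProductSpace.toDual ℝ E3).symm (fderiv ℝ (w x) b) := rfl

theorem hasFDerivAt_dw (hw : ContDiff ℝ 2 (w x)) (b : E3) :
    HasFDerivAt (dw w x) (ddw w x b) b := by
  have h : ContDiff ℝ 1 (dw w x) := by
    rw [dw_eq]
    exact (InnerProductSpace.toDual ℝ E3).symm.contDiff.comp
      (hw.fderiv_right (m := 1) (by norm_num))
  exact (h.differentiable (by norm_num) b).hasFDerivAt

/-- Moves the Hessian from the Riesz representative back to the second Fréchet derivative, where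
symmetry is available. -/
theorem inner_ddw (hw : ContDiff ℝ 2 (w x)) (b ξ η : E3) :
    inner ℝ (ddw w x b ξ) η = fderiv ℝ (fderiv ℝ (w x)) b ξ η := by
  have h1 : DifferentiableAt ℝ (fderiv ℝ (w x)) b :=
    (hw.fderiv_right (m := 1) (by norm_num)).differentiable (by norm_num) b
  have h2 : HasFDerivAt (fun y => inner ℝ (dw w x y) η)
      ((fderiv ℝ (fderiv ℝ (w x)) b).flip η) b := by
    have h3 : (fun y => inner ℝ (dw w x y) η) = fun y => fderiv ℝ (w x) y η := by
      ext y
      rw [dw_eq, InnerProductSpace.toDual_symm_apply]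
    rw [h3]
    exact (ContinuousLinearMap.apply ℝ ℝ η).hasFDerivAt.comp b h1.hasFDerivAt
  have h4 := (hasFDerivAt_dw hw b).inner ℝ (hasFDerivAt_const η b)
  have h5 := congrArg (fun A => A ξ) (h4.unique h2)
  simpa using h5

theorem inner_ddw_comm (hw : ContDiff ℝ 2 (w x)) (b ξ η : E3) :
    inner ℝ (ddw w x b ξ) η = inner ℝ (ddw w x b η) ξ := by
  rw [inner_ddw hw, inner_ddw hw]
  exact (hw.contDiffAt (x := b)).isSymmSndFDerivAt (by simp) ξ η

theorem hasDerivAt_line (hw : ContDiff ℝ 2 (w x)) (b d : E3) (t : ℝ) :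
    HasDerivAt (fun t : ℝ => w x (b + t • d)) (inner ℝ (dw w x (b + t • d)) d) t := by
  have h1 : HasDerivAt (fun t : ℝ => b + t • d) ((1 : ℝ) • d) t :=
    ((hasDerivAt_id t).smul_const d).const_add b
  have h2 := (hasGradientAt_dw hw (b + t • d)).hasFDerivAt.comp_hasDerivAt t h1
  simpa [Function.comp_def] using h2

theorem hasDerivAt_dw_line (hw : ContDiff ℝ 2 (w x)) (b d : E3) (t : ℝ) :
    HasDerivAt (fun t : ℝ => inner ℝ (dw w x (b + t • d)) d)
      (inner ℝ (ddw w x (b + t • d) d) d) t := by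
  have h1 : HasDerivAt (fun t : ℝ => b + t • d) ((1 : ℝ) • d) t :=
    ((hasDerivAt_id t).smul_const d).const_add b
  have h2 := (hasFDerivAt_dw hw (b + t • d)).comp_hasDerivAt t h1
  have h3 := h2.inner ℝ (hasDerivAt_const t d)
  simpa using h3

theorem density_lower (hw : ContDiff ℝ 2 (w x)) {γ : ℝ}
    (h : ∀ ξ η : E3, γ * ‖ξ‖ ^ 2 ≤ inner ℝ (ddw w x η ξ) ξ) (b d : E3) :
    w x b + inner ℝ (dw w x b) d + γ / 2 * ‖d‖ ^ 2 ≤ w x (b + d) := by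
  have := taylor_lower_of_le_second_deriv (hasDerivAt_line hw b d) (hasDerivAt_dw_line hw b d)
    (fun t => h d (b + t • d))
  simp only [zero_smul, add_zero, one_smul] at this
  linarith

theorem density_upper (hw : ContDiff ℝ 2 (w x)) {L : ℝ}
    (h : ∀ ξ η : E3, inner ℝ (ddw w x η ξ) ξ ≤ L * ‖ξ‖ ^ 2) (b d : E3) :
    w x (b + d) ≤ w x b + inner ℝ (dw w x b) d + L / 2 * ‖d‖ ^ 2 := by
  -- The lower bound is applied to the negated function.
  have := taylor_lower_of_le_second_deriv (fun t => (hasDerivAt_line hw b d t).neg)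
    (fun t => (hasDerivAt_dw_line hw b d t).neg) (fun t => neg_le_neg (h d (b + t • d)))
  simp only [Pi.neg_apply, zero_smul, add_zero, one_smul] at this
  linarith

/-- Expansion at 0 provides `γ/2 * ‖b‖²`; Young's inequality spends half of it on the linear term.
-/
theorem density_coercive (hw : ContDiff ℝ 2 (w x)) {γ : ℝ} (hγ : 0 < γ)
    (h : ∀ ξ η : E3, γ * ‖ξ‖ ^ 2 ≤ inner ℝ (ddw w x η ξ) ξ) (p : E3) :
    ∃ C : ℝ, ∀ b, C + γ / 4 * ‖b‖ ^ 2 ≤ w x b - inner ℝ p b := by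
  refine ⟨w x 0 - ‖dw w x 0 - p‖ ^ 2 / γ, fun b => ?_⟩
  have h1 := density_lower hw h 0 b
  rw [zero_add] at h1
  have h2 : -(‖dw w x 0 - p‖ * ‖b‖) ≤ inner ℝ (dw w x 0 - p) b :=
    (abs_le.1 (abs_real_inner_le_norm _ _)).1
  rw [inner_sub_left] at h2
  have h3 : ‖dw w x 0 - p‖ * ‖b‖ ≤ ‖dw w x 0 - p‖ ^ 2 / γ + γ / 4 * ‖b‖ ^ 2 := by
    rw [div_add' _ _ _ hγ.ne', le_div_iff₀ hγ]
    nlinarith [sq_nonneg (‖dw w x 0 - p‖ - γ / 2 * ‖b‖)]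
  linarith

end density

/-- A weighted sum of continuous coercive functions attains its minimum on a subspace. -/
theorem exists_minimizer_weighted_sum {J E : Type*} [Fintype J] [NormedAddCommGroup E]
    [NormedSpace ℝ E] [FiniteDimensional ℝ E] {r : J → ℝ} (hr : ∀ j, 0 < r j) {f : J → E → ℝ}
    (hf : ∀ j, Continuous (f j)) {c : ℝ} (hc : 0 < c)
    (hcoer : ∀ j, ∃ C : ℝ, ∀ b, C + c * ‖b‖ ^ 2 ≤ f j b) (S : Submodule ℝ (J → E)) :
    ∃ y ∈ S, ∀ z ∈ S, ∑ j, f j (y j) * r j ≤ ∑ j, f j (z j) * r j := by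
  choose C hC using hcoer
  obtain ⟨m, hm, hmr⟩ : ∃ m : ℝ, 0 < m ∧ ∀ j, m ≤ r j := by
    cases isEmpty_or_nonempty J with
    | inl _ => exact ⟨1, one_pos, fun j => isEmptyElim j⟩
    | inr _ =>
      obtain ⟨j, hj⟩ := Finite.exists_min r
      exact ⟨r j, hr j, hj⟩
  -- The norm on `J → E` is the maximum norm, whose square is below the sum of squares.
  have hlow : ∀ y : J → E, ∑ j, C j * r j + c * m * ‖y‖ ^ 2 ≤ ∑ j, f j (y j) * r j := by
    intro y
    have h1 : ‖y‖ ^ 2 ≤ ∑ j, ‖y j‖ ^ 2 := by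
      refine (Real.le_sqrt (norm_nonneg _) (by positivity)).1 ?_
      refine (pi_norm_le_iff_of_nonneg (Real.sqrt_nonneg _)).2 fun j => ?_
      exact Real.le_sqrt_of_sq_le
        (Finset.single_le_sum (f := fun j => ‖y j‖ ^ 2) (fun _ _ => by positivity)
          (Finset.mem_univ j))
    calc ∑ j, C j * r j + c * m * ‖y‖ ^ 2
        ≤ ∑ j, C j * r j + c * m * ∑ j, ‖y j‖ ^ 2 := by gcongr
      _ = ∑ j, (C j * r j + c * ‖y j‖ ^ 2 * m) := by
          rw [Finset.sum_add_distrib, Finset.mul_sum]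
          congr 1
          exact Finset.sum_congr rfl fun j _ => by ring
      _ ≤ ∑ j, f j (y j) * r j := by
          refine Finset.sum_le_sum fun j _ => ?_
          have h2 : c * ‖y j‖ ^ 2 * m ≤ c * ‖y j‖ ^ 2 * r j := by
            gcongr
            exact hmr j
          have h3 := mul_le_mul_of_nonneg_right (hC j (y j)) (hr j).le
          linarith
  have hcont : Continuous fun y : S => ∑ j, f j ((y : J → E) j) * r j :=
    continuous_finsetSum _ fun j _ =>
      ((hf j).comp ((continuous_apply j).comp continuous_subtype_val)).mul continuous_const
  have : ProperSpace S := FiniteDimensional.proper_real S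
  have hlim : Tendsto (fun y : S => ∑ j, f j ((y : J → E) j) * r j) (cocompact S) atTop := by
    refine tendsto_atTop_mono (fun y : S => hlow y) ?_
    refine tendsto_atTop_add_const_left _ _ (Tendsto.const_mul_atTop (by positivity) ?_)
    exact (tendsto_pow_atTop (by norm_num)).comp (tendsto_norm_cocompact_atTop (E := S))
  obtain ⟨y, hy⟩ := hcont.exists_forall_le hlim
  exact ⟨y, y.2, fun z hz => hy ⟨z, hz⟩⟩

/-! ### Curl of piecewise polynomials -/

theorem curlP_add (p q : PolyVec) : curlP (p + q) = curlP p + curlP q := by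
  ext1 i
  fin_cases i <;> simp [curlP] <;> ring

theorem curlP_smul (c : ℝ) (p : PolyVec) : curlP (c • p) = c • curlP p := by
  ext1 i
  fin_cases i <;> simp [curlP, smul_sub]

theorem curlPw_sub {ι : Type*} (u v : ι → PolyVec) : curlPw (u - v) = curlPw u - curlPw v := by
  ext1 i
  change curlP (u i - v i) = curlP (u i) - curlP (v i)
  rw [sub_eq_add_neg, ← neg_one_smul ℝ (v i), curlP_add, curlP_smul, neg_one_smul, sub_eq_add_neg]

/-- The value at `x` of the curl on the `i`-th element, as a linear map. -/
noncomputable def curlAt {ι : Type*} (i : ι) (x : E3) : (ι → PolyVec) →ₗ[ℝ] E3 where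
  toFun v := evalV (curlPw v i) x
  map_add' u v := by simp [curlPw, curlP_add, evalV_add]
  map_smul' c v := by simp [curlPw, curlP_smul, evalV_smul]

theorem curlAt_apply {ι : Type*} (i : ι) (x : E3) (v : ι → PolyVec) :
    evalV (curlPw v i) x = curlAt i x v := rfl

theorem pderiv_mem_restrictTotalDegree {p : Poly} {k : ℕ} (i : Fin 3)
    (hp : p ∈ MvPolynomial.restrictTotalDegree (Fin 3) ℝ (k + 1)) :
    MvPolynomial.pderiv i p ∈ MvPolynomial.restrictTotalDegree (Fin 3) ℝ k := by
  rw [MvPolynomial.mem_restrictTotalDegree] at hp ⊢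
  refine Finset.sup_le fun m hm => ?_
  rw [MvPolynomial.mem_support_iff, MvPolynomial.coeff_pderiv] at hm
  have h := (MvPolynomial.le_totalDegree
    (MvPolynomial.mem_support_iff.2 (left_ne_zero_of_mul hm))).trans hp
  rw [Finsupp.sum_add_index' (fun _ => rfl) (fun _ _ _ => rfl),
    Finsupp.sum_single_index rfl] at h
  omega

/-- Nédélec fields have degree at most `k + 1` and the curl lowers it by one, which is what lets
exactness for degree `k` apply to curls. -/
theorem curlP_mem_of_nedelecLocal {p : PolyVec} {k : ℕ} (hp : p ∈ nedelecLocal k) (i : Fin 3) :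
    curlP p i ∈ MvPolynomial.restrictTotalDegree (Fin 3) ℝ k := by
  have h : ∀ j, p j ∈ MvPolynomial.restrictTotalDegree (Fin 3) ℝ (k + 1) := by
    obtain ⟨r, q, hr, hq, rfl⟩ := hp
    have hr' : ∀ j, r j ∈ MvPolynomial.restrictTotalDegree (Fin 3) ℝ (k + 1) := fun j => by
      have := hr j
      rw [MvPolynomial.mem_restrictTotalDegree] at this ⊢
      omega
    have hX : ∀ a b : Fin 3, (MvPolynomial.X a : Poly) * q b ∈
        MvPolynomial.restrictTotalDegree (Fin 3) ℝ (k + 1) := fun a b => by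
      rw [MvPolynomial.mem_restrictTotalDegree]
      refine (MvPolynomial.totalDegree_mul _ _).trans ?_
      have := ((MvPolynomial.mem_homogeneousSubmodule _ _).1 (hq b)).totalDegree_le
      rw [MvPolynomial.totalDegree_X]
      omega
    intro j
    refine Submodule.add_mem _ (hr' j) ?_
    fin_cases j <;> simp only [cross_apply] <;>
      exact Submodule.sub_mem _ (hX _ _) (hX _ _)
  have hd := fun a b => pderiv_mem_restrictTotalDegree a (h b)
  fin_cases i <;> exact Submodule.sub_mem _ (hd _ _) (hd _ _)

/-! ### Tetrahedra and meshes -/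

theorem refMap_mem_tet (S : Affine.Simplex ℝ E3 3) {y : E3} (h0 : ∀ i, 0 ≤ y i)
    (h1 : ∑ i, y i ≤ 1) : refMap S y ∈ tet S := by
  -- The barycentric coordinates are `1 - ∑ yᵢ` and the `yᵢ`.
  have h : refMap S y = ∑ m : Fin 4, (Fin.cons (1 - ∑ i, y i) (fun i => y i) : Fin 4 → ℝ) m •
      S.points m := by
    rw [Fin.sum_univ_succ]
    simp only [refMap, Fin.cons_zero, Fin.cons_succ, smul_sub, Finset.sum_sub_distrib,
      sub_smul, one_smul, Finset.sum_smul]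
    abel
  rw [h]
  refine (convex_convexHull ℝ _).sum_mem (fun m _ => ?_) ?_
    fun m _ => subset_convexHull ℝ _ (Set.mem_range_self m)
  · refine Fin.cases ?_ (fun i => ?_) m
    · simpa using h1
    · simpa using h0 i
  · rw [Fin.sum_univ_succ]
    simp

theorem volume_tet_ne_top (S : Affine.Simplex ℝ E3 3) : volume (tet S) ≠ ⊤ :=
  ((Set.finite_range S.points).isCompact_convexHull ℝ).measure_lt_top.ne

theorem volume_tet_pos {S : Affine.Simplex ℝ E3 3} (h : (interior (tet S)).Nonempty) :
    0 < volume.real (tet S) :=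
  ENNReal.toReal_pos (Measure.measure_pos_of_nonempty_interior _ h).ne' (volume_tet_ne_top S)

/-- Nonempty interior would make the affine span of `A` the whole space, so it would contain a
vertex missing from `A`, against affine independence. -/
theorem interior_convexHull_eq_empty_of_ssubset {S : Affine.Simplex ℝ E3 3} {A : Set E3}
    (hA : A ⊂ Set.range S.points) : interior (convexHull ℝ A) = ∅ := by
  by_contra hne
  rw [← Ne, ← Set.nonempty_iff_ne_empty, interior_convexHull_nonempty_iff_affineSpan_eq_top] at hne
  obtain ⟨hsub, hnot⟩ := hA
  obtain ⟨_, ⟨m, rfl⟩, hm⟩ := Set.not_subset.1 hnot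
  refine S.independent.notMem_affineSpan_sdiff m Set.univ ?_
  have h : A ⊆ S.points '' (Set.univ \ {m}) := by
    intro a ha
    obtain ⟨n, rfl⟩ := hsub ha
    refine ⟨n, ⟨trivial, fun hn => ?_⟩, rfl⟩
    rw [Set.mem_singleton_iff] at hn
    exact hm (hn ▸ ha)
  refine affineSpan_mono ℝ h ?_
  rw [hne]
  trivial

theorem IsConformingMesh.disjoint_interior {ι : Type*} {Ω : Set E3}
    {T : ι → Affine.Simplex ℝ E3 3} (hT : IsConformingMesh Ω T) {i j : ι} (hij : i ≠ j) :
    Disjoint (interior (tet (T i))) (interior (tet (T j))) := by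
  rw [Set.disjoint_iff_inter_eq_empty, ← interior_inter, hT.conforming i j hij]
  refine interior_convexHull_eq_empty_of_ssubset (S := T i) ⟨Set.inter_subset_left, fun h => ?_⟩
  -- Both vertex sets have four elements, so inclusion would be equality.
  refine hT.distinct i j hij (Set.eq_of_subset_of_ncard_le (fun x hx => (h hx).2) ?_
    (Set.finite_range _))
  rw [← Set.image_univ, ← Set.image_univ, Set.ncard_image_of_injective _ (T i).independent.injective,
    Set.ncard_image_of_injective _ (T j).independent.injective]

theorem IsShapeRegular.interior_nonempty {ι : Type*} {κ : ℝ} {T : ι → Affine.Simplex ℝ E3 3}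
    (h : IsShapeRegular κ T) (i : ι) : (interior (tet (T i))).Nonempty := by
  obtain ⟨c, r, hr, hsub, -⟩ := h i
  exact ⟨c, interior_maximal hsub Metric.isOpen_ball (Metric.mem_ball_self hr)⟩

theorem IsConformingMesh.tet_subset {ι : Type*} {Ω : Set E3} {T : ι → Affine.Simplex ℝ E3 3}
    (hT : IsConformingMesh Ω T) (i : ι) : tet (T i) ⊆ closure Ω :=
  hT.cover ▸ Set.subset_iUnion (fun i => tet (T i)) i

theorem IsConformingMesh.glueV_eq {ι : Type*} [Fintype ι] {Ω : Set E3}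
    {T : ι → Affine.Simplex ℝ E3 3} (hT : IsConformingMesh Ω T) (v : ι → PolyVec) {i : ι} {x : E3}
    (hx : x ∈ interior (tet (T i))) : glueV T v x = evalV (v i) x := by
  rw [glueV, Finset.sum_eq_single i, Set.indicator_of_mem hx]
  · intro j _ hj
    exact Set.indicator_of_notMem
      (fun hx' => Set.disjoint_left.1 (hT.disjoint_interior hj) hx' hx) _
  · exact fun h => (h (Finset.mem_univ i)).elim

/-! ### Polynomials are determined by their values on open sets -/

theorem continuous_evalV (p : PolyVec) : Continuous (evalV p) := by
  refine (PiLp.continuous_toLp 2 _).comp (continuous_pi fun i => ?_)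
  exact (MvPolynomial.continuous_eval (p i)).comp (PiLp.continuous_ofLp 2 _)

/-- An open set contains a box, and a polynomial vanishing on a product of infinite sets is zero. -/
theorem eq_zero_of_evalV_eq_zero {p : PolyVec} {U : Set E3} (hU : IsOpen U) (hne : U.Nonempty)
    (h : ∀ x ∈ U, evalV p x = 0) : p = 0 := by
  obtain ⟨a, ha⟩ := hne
  have hU' : IsOpen (WithLp.toLp 2 ⁻¹' U : Set (Fin 3 → ℝ)) :=
    hU.preimage (PiLp.continuous_toLp 2 _)
  obtain ⟨ε, hε, hsub⟩ := Metric.isOpen_iff.1 hU' (WithLp.ofLp a) ha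
  ext1 i
  refine MvPolynomial.funext_set (fun m => Metric.ball (a m) ε) (fun m => ?_) fun x hx => ?_
  · rw [Real.ball_eq_Ioo]
    exact Set.Ioo_infinite (by linarith)
  · have hx' : WithLp.toLp 2 x ∈ U := hsub (by rw [ball_pi _ hε]; exact hx)
    have := congrArg (fun y : E3 => y i) (h _ hx')
    simpa [evalV, evalS] using this

theorem eq_zero_of_normSqL2_nonpos {ι : Type*} [Fintype ι] {Ω : Set E3}
    {T : ι → Affine.Simplex ℝ E3 3} (hΩ : IsOpen Ω) (hT : IsConformingMesh Ω T)
    (hne : ∀ i, (interior (tet (T i))).Nonempty) {v : ι → PolyVec} (hv : MemL2 Ω (glueV T v))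
    (h : normSqL2 Ω T v ≤ 0) : v = 0 := by
  -- Without integrability the integral would be 0 by convention and carry no information.
  have hint : Integrable (fun x => ‖glueV T v x‖ ^ 2) (volume.restrict Ω) :=
    hv.integrable_norm_pow (by norm_num)
  have h0 : normSqL2 Ω T v = 0 := le_antisymm h (integral_nonneg fun x => by positivity)
  have hae := (integral_eq_zero_iff_of_nonneg (fun x => by positivity) hint).1 h0
  ext1 i
  have hopen : IsOpen (interior (tet (T i)) ∩ Ω) := isOpen_interior.inter hΩ
  refine eq_zero_of_evalV_eq_zero hopen ?_ ?_
  -- Elements lie only in the closure of `Ω`; an open set meeting the closure meets `Ω`.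
  · obtain ⟨x, hx⟩ := hne i
    exact mem_closure_iff.1 (hT.tet_subset i (interior_subset hx)) _ isOpen_interior hx
  · have hae' : evalV (v i) =ᵐ[volume.restrict (interior (tet (T i)) ∩ Ω)] fun _ => 0 := by
      filter_upwards [ae_restrict_of_ae_restrict_of_subset Set.inter_subset_right hae,
        ae_restrict_mem hopen.measurableSet] with x hx hxU
      rw [hT.glueV_eq v hxU.1] at hx
      simpa using hx
    exact Measure.eqOn_open_of_ae_eq hae' hopen (continuous_evalV _).continuousOn
      continuousOn_const

/-! ### Quadrature -/

section quad

variable {ι : Type*} [Fintype ι] {ℓ : ℕ} (T : ι → Affine.Simplex ℝ E3 3) (Q : QuadRule ℓ)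

/-- Quadrature as a linear functional. -/
noncomputable def quadL : (ι → E3 → ℝ) →ₗ[ℝ] ℝ where
  toFun := quad T Q
  map_add' f g := by simp [quad, add_mul, Finset.sum_add_distrib]
  map_smul' c f := by simp [quad, Finset.mul_sum, mul_assoc]

theorem quad_add (f g : ι → E3 → ℝ) :
    quad T Q (fun i x => f i x + g i x) = quad T Q f + quad T Q g :=
  (quadL T Q).map_add f g

theorem quad_sub (f g : ι → E3 → ℝ) :
    quad T Q (fun i x => f i x - g i x) = quad T Q f - quad T Q g :=
  (quadL T Q).map_sub f g

theorem quad_const_mul (c : ℝ) (f : ι → E3 → ℝ) :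
    quad T Q (fun i x => c * f i x) = c * quad T Q f :=
  (quadL T Q).map_smul c f

variable {T Q}

/-- Positive weights and nodes inside the closed element carry pointwise inequalities over to the
discrete forms. -/
theorem quad_mono {f g : ι → E3 → ℝ} (h : ∀ i, ∀ x ∈ tet (T i), f i x ≤ g i x) :
    quad T Q f ≤ quad T Q g := by
  refine Finset.sum_le_sum fun i _ => Finset.sum_le_sum fun j _ => ?_
  refine mul_le_mul_of_nonneg_right (mul_le_mul_of_nonneg_right ?_ (Q.wt_pos j).le)
    measureReal_nonneg
  exact h i _ (refMap_mem_tet _ (Q.pt_nonneg j) (Q.pt_sum_le j))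

theorem quad_congr {f g : ι → E3 → ℝ} (h : ∀ i, ∀ x ∈ tet (T i), f i x = g i x) :
    quad T Q f = quad T Q g :=
  le_antisymm (quad_mono fun i x hx => (h i x hx).le) (quad_mono fun i x hx => (h i x hx).ge)

theorem quad_nonneg {f : ι → E3 → ℝ} (h : ∀ i, ∀ x ∈ tet (T i), 0 ≤ f i x) : 0 ≤ quad T Q f := by
  have h0 := (quadL T Q).map_zero
  exact h0.ge.trans (quad_mono h)

end quad

/-! ### The discrete energy -/

section model

variable {ι : Type*} [Fintype ι] {ℓ : ℕ} (T : ι → Affine.Simplex ℝ E3 3) (Q : QuadRule ℓ)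
  (w : E3 → E3 → ℝ) (hs : E3 → E3)

/-- The squared norm of the curl, computed by quadrature. -/
noncomputable def curlNormSq (v : ι → PolyVec) : ℝ :=
  quad T Q fun i x => ‖curlAt i x v‖ ^ 2

/-- `residual` as a linear functional. -/
noncomputable def residualL (a : ι → PolyVec) : (ι → PolyVec) →ₗ[ℝ] ℝ where
  toFun := residual T Q w hs a
  map_add' u v := by
    simp only [residual, curlAt_apply, map_add, inner_add_right, quad_add]
  map_smul' c v := by
    simp only [residual, curlAt_apply, map_smul, real_inner_smul_right, quad_const_mul,
      RingHom.id_apply, smul_eq_mul]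

/-- `hessianForm` as a bilinear form. -/
noncomputable def hessianL (a : ι → PolyVec) : (ι → PolyVec) →ₗ[ℝ] (ι → PolyVec) →ₗ[ℝ] ℝ :=
  LinearMap.mk₂ ℝ (hessianForm T Q w a)
    (fun u v z => by
      simp only [hessianForm, curlAt_apply, map_add, inner_add_left, quad_add])
    (fun c u v => by
      simp only [hessianForm, curlAt_apply, map_smul, real_inner_smul_left, quad_const_mul,
        smul_eq_mul])
    (fun u v z => by
      simp only [hessianForm, curlAt_apply, map_add, inner_add_right, quad_add])
    (fun c u v => by
      simp only [hessianForm, curlAt_apply, map_smul, real_inner_smul_right, quad_const_mul,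
        smul_eq_mul])

theorem energy_eq (v : ι → PolyVec) :
    energy T Q w hs v = quad T Q fun i x =>
      w x (curlAt i x v) - inner ℝ (elementValue hs (tet (T i)) x) (curlAt i x v) := by
  rw [quad_sub]; rfl

variable {T Q w hs} {Ω : Set E3} {γ L : ℝ}

/-- A simply connected space is nonempty, so both Hessian bounds can be tested on a unit vector at
one point. -/
theorem ProblemData.le (hdata : ProblemData Ω w hs γ L) : γ ≤ L := by
  have := hdata.domain.simplyConnected
  obtain ⟨x⟩ := (inferInstance : PathConnectedSpace Ω).nonempty
  have hx := subset_closure x.2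
  have h := (hdata.lower x hx (EuclideanSpace.single 0 1) 0).trans
    (hdata.upper x hx (EuclideanSpace.single 0 1) 0)
  simpa using h

theorem isNewtonModel (hdata : ProblemData Ω w hs γ L) (hT : ∀ i, tet (T i) ⊆ closure Ω)
    {Vh : Submodule ℝ (ι → PolyVec)} (hdef : ∀ v ∈ Vh, curlNormSq T Q v = 0 → v = 0) :
    IsNewtonModel Vh (energy T Q w hs) (residualL T Q w hs) (hessianL T Q w)
      (curlNormSq T Q) γ L where
  pos := hdata.γ_pos
  le := hdata.le
  lower a d := by
    change energy T Q w hs a + residual T Q w hs a d + γ / 2 * curlNormSq T Q d ≤ _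
    rw [energy_eq, energy_eq, residual, curlNormSq, ← quad_const_mul, ← quad_add, ← quad_add]
    refine quad_mono fun i x hx => ?_
    have h := density_lower (hdata.smooth x (hT i hx)) (hdata.lower x (hT i hx))
      (curlAt i x a) (curlAt i x d)
    simp only [curlAt_apply, map_add, inner_add_right, inner_sub_left]
    linarith
  upper a d := by
    change _ ≤ energy T Q w hs a + residual T Q w hs a d + L / 2 * curlNormSq T Q d
    rw [energy_eq, energy_eq, residual, curlNormSq, ← quad_const_mul, ← quad_add, ← quad_add]
    refine quad_mono fun i x hx => ?_
    have h := density_upper (hdata.smooth x (hT i hx)) (hdata.upper x (hT i hx))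
      (curlAt i x a) (curlAt i x d)
    simp only [curlAt_apply, map_add, inner_add_right, inner_sub_left]
    linarith
  hess_lower a d := by
    change _ ≤ hessianForm T Q w a d d
    rw [hessianForm, curlNormSq, ← quad_const_mul]
    exact quad_mono fun i x hx => hdata.lower x (hT i hx) _ _
  hess_upper a d := by
    change hessianForm T Q w a d d ≤ _
    rw [hessianForm, curlNormSq, ← quad_const_mul]
    exact quad_mono fun i x hx => hdata.upper x (hT i hx) _ _
  symm a d e := by
    change hessianForm T Q w a d e = hessianForm T Q w a e d
    rw [hessianForm, hessianForm]
    exact quad_congr fun i x hx => inner_ddw_comm (hdata.smooth x (hT i hx)) _ _ _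
  smul t d := by
    rw [curlNormSq, curlNormSq, ← quad_const_mul]
    simp only [map_smul, norm_smul, mul_pow, Real.norm_eq_abs, sq_abs]
  nonneg d := quad_nonneg fun i x _ => by positivity
  definite := hdef

variable (T Q) in
/-- The values of the curl at all quadrature points. -/
noncomputable def curlSamples : (ι → PolyVec) →ₗ[ℝ] (ι × Fin ℓ → E3) :=
  LinearMap.pi fun p => curlAt p.1 (refMap (T p.1) (Q.pt p.2))

/-- By definiteness, a field in `Vh` is determined by its finitely many curl samples. -/
theorem finiteDimensional_of_definite {Vh : Submodule ℝ (ι → PolyVec)}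
    (hdef : ∀ v ∈ Vh, curlNormSq T Q v = 0 → v = 0) : FiniteDimensional ℝ Vh := by
  refine FiniteDimensional.of_injective ((curlSamples T Q).comp Vh.subtype) ?_
  rw [← LinearMap.ker_eq_bot, LinearMap.ker_eq_bot']
  intro v hv
  refine Subtype.ext (hdef v v.2 ?_)
  refine Finset.sum_eq_zero fun i _ => Finset.sum_eq_zero fun j _ => ?_
  have h : curlAt i (refMap (T i) (Q.pt j)) (v : ι → PolyVec) = 0 := congrFun hv (i, j)
  simp [h]

/-- The energy sees `v` only through its curl samples. On their image it is a weighted sum of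
coercive functions, and a minimizer there lifts to `Vh`. -/
theorem exists_isDiscreteSolution (hdata : ProblemData Ω w hs γ L)
    (hT : ∀ i, tet (T i) ⊆ closure Ω) (hvol : ∀ i, 0 < volume.real (tet (T i)))
    (Vh : Submodule ℝ (ι → PolyVec)) : ∃ a, IsDiscreteSolution T Q w hs Vh a := by
  have hx : ∀ p : ι × Fin ℓ, refMap (T p.1) (Q.pt p.2) ∈ closure Ω := fun p =>
    hT _ (refMap_mem_tet _ (Q.pt_nonneg p.2) (Q.pt_sum_le p.2))
  obtain ⟨_, ⟨a, ha, rfl⟩, hmin⟩ := exists_minimizer_weighted_sum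
    (r := fun p : ι × Fin ℓ => Q.wt p.2 * volume.real (tet (T p.1)))
    (f := fun p b => w (refMap (T p.1) (Q.pt p.2)) b -
      inner ℝ (elementValue hs (tet (T p.1)) (refMap (T p.1) (Q.pt p.2))) b)
    (fun p => mul_pos (Q.wt_pos _) (hvol _))
    (fun p => (hdata.smooth _ (hx p)).continuous.sub (continuous_const.inner continuous_id))
    (c := γ / 4) (by linarith [hdata.γ_pos])
    (fun p => density_coercive (hdata.smooth _ (hx p)) hdata.γ_pos (hdata.lower _ (hx p)) _)
    (Vh.map (curlSamples T Q))
  have hE : ∀ v, energy T Q w hs v = ∑ p : ι × Fin ℓ,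
      (w (refMap (T p.1) (Q.pt p.2)) (curlSamples T Q v p) -
        inner ℝ (elementValue hs (tet (T p.1)) (refMap (T p.1) (Q.pt p.2)))
          (curlSamples T Q v p)) * (Q.wt p.2 * volume.real (tet (T p.1))) := by
    intro v
    rw [energy_eq, quad, Fintype.sum_prod_type]
    simp only [mul_assoc]
    rfl
  refine ⟨a, ha, fun v hv => ?_⟩
  rw [hE, hE]
  exact hmin _ ⟨v, hv, rfl⟩

end model

/-! ### Exactness of the quadrature and definiteness on `Vh`. -/

section discrete

variable {ι : Type*} [Fintype ι] {ℓ : ℕ} {T : ι → Affine.Simplex ℝ E3 3} {Q : QuadRule ℓ}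
  {hs : E3 → E3} {Ω : Set E3} {κ : ℝ} {k : ℕ} {Vh : Submodule ℝ (ι → PolyVec)} {Cstar : ℝ}

theorem DiscreteData.mem_nedelecSpace (hdisc : DiscreteData Ω hs T κ k Q Vh Cstar)
    {v : ι → PolyVec} (hv : v ∈ Vh) : v ∈ nedelecSpace Ω T k :=
  hdisc.split_sup ▸ (le_sup_right : Vh ≤ gradLagrange Ω T k ⊔ Vh) hv

theorem DiscreteData.normSqL2_curlPw (hdisc : DiscreteData Ω hs T κ k Q Vh Cstar)
    {v : ι → PolyVec} (hv : v ∈ Vh) : normSqL2 Ω T (curlPw v) = curlNormSq T Q v := by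
  have hdeg : ∀ i j, curlPw v i j ∈ MvPolynomial.restrictTotalDegree (Fin 3) ℝ k :=
    fun i j => curlP_mem_of_nedelecLocal ((hdisc.mem_nedelecSpace hv).1 i) j
  have h := hdisc.exact (curlPw v) (curlPw v) hdeg hdeg
  simp only [real_inner_self_eq_norm_sq] at h
  exact h.symm

/-- A vanishing discrete curl norm is a vanishing L² curl norm by exactness, and stability then
kills the L² norm of `v` itself. -/
theorem DiscreteData.definite (hdisc : DiscreteData Ω hs T κ k Q Vh Cstar) (hΩ : IsOpen Ω) :
    ∀ v ∈ Vh, curlNormSq T Q v = 0 → v = 0 := by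
  intro v hv h0
  refine eq_zero_of_normSqL2_nonpos hΩ hdisc.mesh hdisc.shape.interior_nonempty
    (hdisc.mem_nedelecSpace hv).2.1 ?_
  have h := hdisc.stable.2 v hv
  rw [hdisc.normSqL2_curlPw hv, h0, Real.sqrt_zero, mul_zero, add_zero] at h
  exact Real.sqrt_eq_zero'.1 (le_antisymm h (Real.sqrt_nonneg _))

end discrete

/-! ### The iterates -/

section iterates

variable {ι : Type*} [Fintype ι] {ℓ : ℕ} {T : ι → Affine.Simplex ℝ E3 3} {Q : QuadRule ℓ}
  {w : E3 → E3 → ℝ} {hs : E3 → E3} {γ L ρ σ : ℝ} {Vh : Submodule ℝ (ι → PolyVec)}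
  {a0 : ι → PolyVec}

theorem IsNewtonArmijo.mem {a δ : ℕ → ι → PolyVec} {τ : ℕ → ℝ}
    (h : IsNewtonArmijo T Q w hs Vh ρ σ a0 a δ τ) (h0 : a0 ∈ Vh) (n : ℕ) : a n ∈ Vh := by
  induction n with
  | zero => exact h.init ▸ h0
  | succ n ih =>
    rw [h.update]
    exact Vh.add_mem ih (Vh.smul_mem _ (h.increment_mem n))

/-- Direction and step are functions `D`, `t` of the current iterate, so the method is a recursion
and uniqueness is an induction. -/
theorem existsUnique_isNewtonArmijo
    (hM : IsNewtonModel Vh (energy T Q w hs) (residualL T Q w hs) (hessianL T Q w)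
      (curlNormSq T Q) γ L) [FiniteDimensional ℝ Vh] (hρ : 0 < ρ) (hρ' : ρ ≤ 1 / 2)
    (hσ' : σ < 1 / 2) (a0 : ι → PolyVec) :
    ∃! s : (ℕ → ι → PolyVec) × (ℕ → ι → PolyVec) × (ℕ → ℝ),
      IsNewtonArmijo T Q w hs Vh ρ σ a0 s.1 s.2.1 s.2.2 := by
  choose D hD hDu using fun a => hM.existsUnique_direction a
  choose t ht using fun a => hM.exists_step (σ := σ) ((hD a).2 _ (hD a).1) hρ hρ' hσ'
  let a : ℕ → ι → PolyVec := fun n => Nat.rec a0 (fun _ b => b + t b • D b) n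
  refine ⟨⟨a, fun n => D (a n), fun n => t (a n)⟩, ⟨rfl, fun n => (hD (a n)).1,
    fun n => (hD (a n)).2, fun n => ht (a n), fun n => rfl⟩, ?_⟩
  rintro ⟨b, δ, τ⟩ ⟨h1, h2, h3, h4, h5⟩
  dsimp only at h1 h2 h3 h4 h5
  have hδ : ∀ n, δ n = D (b n) := fun n => hDu _ _ ⟨h2 n, h3 n⟩
  have hτ : ∀ n, τ n = t (b n) := fun n => by
    have := h4 n
    rw [hδ n] at this
    exact this.unique (ht (b n))
  have hb : ∀ n, b n = a n := by
    intro n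
    induction n with
    | zero => exact h1
    | succ n ih => rw [h5, hδ, hτ, ih]
  refine Prod.ext (funext hb) (Prod.ext (funext fun n => ?_) (funext fun n => ?_))
  · exact (hδ n).trans (congrArg D (hb n))
  · exact (hτ n).trans (congrArg t (hb n))

theorem IsNewtonArmijo.gap_succ
    (hM : IsNewtonModel Vh (energy T Q w hs) (residualL T Q w hs) (hessianL T Q w)
      (curlNormSq T Q) γ L) (hρ : 0 < ρ) (hρ' : ρ ≤ 1 / 2) (hσ : 0 < σ) (hσ' : σ < 1 / 2)
    {ah : ι → PolyVec} (hmin : IsDiscreteSolution T Q w hs Vh ah)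
    {a δ : ℕ → ι → PolyVec} {τ : ℕ → ℝ} (h : IsNewtonArmijo T Q w hs Vh ρ σ a0 a δ τ)
    (h0 : a0 ∈ Vh) (n : ℕ) :
    energy T Q w hs (a (n + 1)) - energy T Q w hs ah ≤
      (1 - 4 * ρ * σ * (1 - σ) * (γ ^ 3 / L ^ 3)) *
        (energy T Q w hs (a n) - energy T Q w hs ah) := by
  rw [h.update]
  exact hM.gap_contraction hmin (h.mem h0 n) (h.increment_mem n) (h.increment n) hρ hρ' hσ hσ'
    (h.step n)

end iterates

theorem rate_mem_Ioo {ρ σ γ L : ℝ} (hρ : 0 < ρ) (hρ' : ρ ≤ 1 / 2) (hσ : 0 < σ) (hσ' : σ < 1 / 2)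
    (hγ : 0 < γ) (hle : γ ≤ L) :
    0 < 1 - 4 * ρ * σ * (1 - σ) * (γ ^ 3 / L ^ 3) ∧
      1 - 4 * ρ * σ * (1 - σ) * (γ ^ 3 / L ^ 3) < 1 := by
  have hL : 0 < L := hγ.trans_le hle
  have hs : 0 < 1 - σ := by linarith
  have h1 : γ ^ 3 / L ^ 3 ≤ 1 := (div_le_one (by positivity)).2 (by gcongr)
  have h2 : 0 < γ ^ 3 / L ^ 3 := by positivity
  -- `4σ(1-σ) ≤ 1` and `ρ ≤ 1/2` keep the product below 1.
  have h3 : 4 * ρ * σ * (1 - σ) < 1 := by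
    calc 4 * ρ * σ * (1 - σ) = ρ * (4 * (σ * (1 - σ))) := by ring
      _ ≤ 1 / 2 * (4 * (σ * (1 - σ))) := by gcongr
      _ < 1 := by nlinarith
  have h4 : 0 < 4 * ρ * σ * (1 - σ) := by positivity
  constructor <;> nlinarith [mul_pos h4 h2]

end Magnetostatics

/-! ### Assembly of the global convergence theorem. -/

theorem theorem4
    (ρ σ γ L : ℝ) (hρ : 0 < ρ) (hρ' : ρ ≤ 1 / 2) (hσ : 0 < σ) (hσ' : σ < 1 / 2)
    (Ω : Set E3) (w : E3 → E3 → ℝ) (hs : E3 → E3) (hdata : ProblemData Ω w hs γ L)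
    {ι : Type*} [Fintype ι] {ℓ : ℕ} (T : ι → Affine.Simplex ℝ E3 3) (κ : ℝ) (k : ℕ)
    (Q : QuadRule ℓ) (Vh : Submodule ℝ (ι → PolyVec)) (Cstar : ℝ)
    (hdisc : DiscreteData Ω hs T κ k Q Vh Cstar) :
    (0 < 1 - 4 * ρ * σ * (1 - σ) * (γ ^ 3 / L ^ 3) ∧
      1 - 4 * ρ * σ * (1 - σ) * (γ ^ 3 / L ^ 3) < 1) ∧
    ∃ ah : ι → PolyVec,
      IsDiscreteSolution T Q w hs Vh ah ∧
      (∀ b : ι → PolyVec, IsDiscreteSolution T Q w hs Vh b → b = ah) ∧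
      ∀ a0 ∈ Vh,
        (∃! s : (ℕ → ι → PolyVec) × (ℕ → ι → PolyVec) × (ℕ → ℝ),
          IsNewtonArmijo T Q w hs Vh ρ σ a0 s.1 s.2.1 s.2.2) ∧
        ∀ (a δ : ℕ → ι → PolyVec) (τ : ℕ → ℝ),
          IsNewtonArmijo T Q w hs Vh ρ σ a0 a δ τ →
          (∀ n, δ n = 0 → ∀ m, n ≤ m → a m = ah) ∧
          ∀ n, normSqL2 Ω T (curlPw (a n) - curlPw ah) ≤
            L / γ * (1 - 4 * ρ * σ * (1 - σ) * (γ ^ 3 / L ^ 3)) ^ n *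
              normSqL2 Ω T (curlPw a0 - curlPw ah) := by
  have hγ := hdata.γ_pos
  have hdef := hdisc.definite hdata.domain.isOpen
  have hM := isNewtonModel hdata hdisc.mesh.tet_subset hdef
  have hfin : FiniteDimensional ℝ Vh := finiteDimensional_of_definite hdef
  have hrate := rate_mem_Ioo hρ hρ' hσ hσ' hγ hdata.le
  obtain ⟨ah, hah⟩ := exists_isDiscreteSolution (Q := Q) hdata hdisc.mesh.tet_subset
    (fun i => volume_tet_pos (hdisc.shape.interior_nonempty i)) Vh
  refine ⟨hrate, ah, hah, fun b hb => hM.eq_of_gap_nonpos hah hb.1 (hb.2 ah hah.1),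
    fun a0 h0 => ⟨existsUnique_isNewtonArmijo hM hρ hρ' hσ' a0, fun a δ τ h => ?_⟩⟩
  have hgap := h.gap_succ hM hρ hρ' hσ hσ' hah h0
  have hmem := h.mem h0
  generalize 1 - 4 * ρ * σ * (1 - σ) * (γ ^ 3 / L ^ 3) = q at hrate hgap ⊢
  refine ⟨fun n hn m hnm => ?_, fun n => ?_⟩
  -- A zero increment makes `H d d`, hence the gap, nonpositive; contraction keeps it so for all
  -- later iterates.
  · refine hM.eq_of_gap_nonpos hah (hmem m) ?_
    induction m, hnm using Nat.le_induction with
    | base =>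
      have h1 := hM.gap_le_hess hah.1 (hmem n) (h.increment n)
      rw [hn, map_zero, mul_zero] at h1
      linarith
    | succ m _ ih => nlinarith [hgap m]
  · have hpow : energy T Q w hs (a n) - energy T Q w hs ah ≤
        q ^ n * (energy T Q w hs a0 - energy T Q w hs ah) := by
      induction n with
      | zero => rw [h.init, pow_zero, one_mul]
      | succ n ih =>
        calc _ ≤ _ := hgap n
          _ ≤ q * (q ^ n * (energy T Q w hs a0 - energy T Q w hs ah)) :=
            mul_le_mul_of_nonneg_left ih hrate.1.le
          _ = _ := by ring
    -- The errors lie in `Vh`, so exactness identifies their L² curl norms with the discrete ones.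
    rw [← curlPw_sub, ← curlPw_sub, hdisc.normSqL2_curlPw (Vh.sub_mem (hmem n) hah.1),
      hdisc.normSqL2_curlPw (Vh.sub_mem h0 hah.1)]
    have h1 := hM.gap_lower hah (hmem n)
    have h2 := mul_le_mul_of_nonneg_left (hM.gap_upper hah h0) (pow_nonneg hrate.1.le n)
    rw [div_mul_eq_mul_div, div_mul_eq_mul_div, le_div_iff₀ hγ]
    linarith
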